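/- For a linear map $\mathcal N$ from $d_A\times d_A$ to $d_B\times d_B$ complex matrices, let $S_0^{\min}(\mathcal N):=\min_\rho \log\operatorname{rank}\mathcal N(\rho)$, where $\rho$ runs over all density matrices (positive semidefinite, trace one) on the input space; a quantum channel is a completely positive, trace preserving linear map. Let $d_A,d_B$ be integers with $d_A>2$, $d_B>2$ and $d_Ad_B$ even. Then there exist quantum channels $\mathcal N_1,\mathcal N_2$ with $d_A$-dimensional input spaces and $d_B$-dimensional output spaces such that $$S_0^{\min}(\mathcal N_1)=S_0^{\min}(\mathcal N_2)=\log d_B,$$ but $$S_0^{\min}(\mathcal N_1\otimes\mathcal N_2)\le\log(d_B^2-1)<2\log d_B .$$ In particular, $S_0^{\min}(\mathcal N_1\otimes\mathcal N_2)<S_0^{\min}(\mathcal N_1)+S_0^{\min}(\mathcal N_2)$, so the minimum output $0$-Rényi entropy is not additive. -/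

import Mathlib

open scoped MatrixOrder Matrix.Norms.L2Operator CStarAlgebra ComplexOrder

/-- A quantum channel from the system with basis `a` to the system with basis `b`: a completely
positive and trace preserving linear map `B(ℂ^a) → B(ℂ^b)`. -/
structure QuantumChannel (a b : Type*) [Fintype a] [DecidableEq a] [Fintype b] [DecidableEq b]
    extends Matrix a a ℂ →CP Matrix b b ℂ where
  trace_map (X : Matrix a a ℂ) : (toLinearMap X).trace = X.trace

/-- The states (normalised density operators) on `ℂ^a`. -/
def DensityMatrix (a : Type*) [Fintype a] : Type _ :=
  {ρ : Matrix a a ℂ // ρ.PosSemidef ∧ ρ.trace = 1}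

/-- The `0`-Rényi entropy `S₀(σ) = log rank σ`. -/
noncomputable def renyiEntropyZero {b : Type*} [Fintype b] (σ : Matrix b b ℂ) : ℝ :=
  Real.log σ.rank

/-- The minimum output `0`-Rényi entropy of a linear map `N`: the minimum of `S₀(N(ρ))` over all
states `ρ` on the input space (the values lie in a finite set, so the infimum is attained). -/
noncomputable def minOutputEntropyZero {a b : Type*} [Fintype a] [Fintype b]
    (N : Matrix a a ℂ →ₗ[ℂ] Matrix b b ℂ) : ℝ :=
  ⨅ ρ : DensityMatrix a, renyiEntropyZero (N ρ.1)

/-- The tensor product `N₁ ⊗ N₂` of linear maps between matrix algebras, with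
`B(ℂ^a) ⊗ B(ℂ^c)` identified with `B(ℂ^(a × c))` by the Kronecker product: it is the linear map
with `(N₁ ⊗ N₂)(X ⊗ Y) = N₁(X) ⊗ N₂(Y)`. -/
noncomputable def tensorMap {a b c d : Type*} [Fintype a] [DecidableEq a] [Fintype b]
    [DecidableEq b] [Fintype c] [DecidableEq c] [Fintype d] [DecidableEq d]
    (N₁ : Matrix a a ℂ →ₗ[ℂ] Matrix b b ℂ) (N₂ : Matrix c c ℂ →ₗ[ℂ] Matrix d d ℂ) :
    Matrix (a × c) (a × c) ℂ →ₗ[ℂ] Matrix (b × d) (b × d) ℂ :=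
  (kroneckerLinearEquiv b b d d ℂ).toLinearMap ∘ₗ
    TensorProduct.map N₁ N₂ ∘ₗ (kroneckerLinearEquiv a a c c ℂ).symm.toLinearMap

/-! For Kraus operators `A i`, the output on a pure state `x` is killed by `y` exactly when `y ⬝ᵥ A
i *ᵥ x = 0` for all `i`. So all outputs have full rank iff the family is product free. If `K` and
`L` are product free but `tr (Kᵢᵀ Lⱼ) = 0`, the family `Kᵢ ⊗ Lⱼ` is orthogonal to a product of two
maximally entangled vectors, one on the inputs and one on the outputs, so the tensor product has a
singular output. Trace preservation is arranged by invertible right factors, which the entangled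
input absorbs (`HasOrthogonalProductFreePair.exists_channels`).

For input dimension `2k`, take the block rows of `(1 | M)` and `(-M | 1)` with `M` symmetric on `ℂ^k
⊗ ℂ^n`. Symmetry gives orthogonality; product freeness says that `M` sends no `u ⊗ y ≠ 0` to some `v
⊗ y`, which `eq_zero_or_eq_zero_of_sum_couplingMatrix` proves for an explicit `M`. Transposition
covers even output dimension. -/

open scoped Kronecker

/-! ### Kraus maps and complete positivity -/

/-- The linear map `X ↦ ∑ i, A i * X * (A i)ᴴ` with Kraus operators `A i`. -/
noncomputable def krausMap {ι a b : Type*} [Fintype ι] [Fintype a] [Fintype b]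
    (A : ι → Matrix b a ℂ) : Matrix a a ℂ →ₗ[ℂ] Matrix b b ℂ where
  toFun X := ∑ i, A i * X * (A i).conjTranspose
  map_add' X Y := by simp [Matrix.mul_add, Matrix.add_mul, Finset.sum_add_distrib]
  map_smul' c X := by simp [Finset.smul_sum]

theorem krausMap_apply {ι a b : Type*} [Fintype ι] [Fintype a] [Fintype b]
    (A : ι → Matrix b a ℂ) (X : Matrix a a ℂ) :
    krausMap A X = ∑ i, A i * X * (A i).conjTranspose := rfl

theorem trace_krausMap {ι a b : Type*} [Fintype ι] [Fintype a] [Fintype b] [DecidableEq a]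
    {A : ι → Matrix b a ℂ} (hA : ∑ i, (A i).conjTranspose * A i = 1) (X : Matrix a a ℂ) :
    (krausMap A X).trace = X.trace := by
  rw [krausMap_apply, Matrix.trace_sum]
  calc ∑ i, (A i * X * (A i).conjTranspose).trace
      = ∑ i, ((A i).conjTranspose * A i * X).trace := by
        refine Finset.sum_congr rfl fun i _ => ?_
        rw [Matrix.trace_mul_comm, Matrix.mul_assoc]
    _ = X.trace := by rw [← Matrix.trace_sum, ← Finset.sum_mul, hA, one_mul]

theorem CStarMatrix.finsetSum_apply {κ m n A : Type*} [AddCommMonoid A] (t : Finset κ)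
    (f : κ → CStarMatrix m n A) (j : m) (l : n) : (∑ i ∈ t, f i) j l = ∑ i ∈ t, f i j l := by
  classical
  induction t using Finset.induction_on with
  | empty => rfl
  | insert i t hi ih => rw [Finset.sum_insert hi, Finset.sum_insert hi, CStarMatrix.add_apply, ih]

theorem krausMap_cstarMatrix_nonneg {ι a b : Type*} [Fintype ι] [Fintype a] [DecidableEq a]
    [Fintype b] [DecidableEq b] [Nonempty b] (A : ι → Matrix b a ℂ) (k : ℕ)
    (M : CStarMatrix (Fin k) (Fin k) (Matrix a a ℂ)) (hM : 0 ≤ M) :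
    0 ≤ M.map (krausMap A) := by
  obtain ⟨q₀⟩ := ‹Nonempty b›
  rw [StarOrderedRing.nonneg_iff] at hM
  induction hM using AddSubmonoid.closure_induction with
  | zero =>
    refine le_of_eq (CStarMatrix.ext fun j l => ?_)
    rw [CStarMatrix.map_apply]
    exact (map_zero (krausMap A)).symm
  | add M₁ M₂ _ _ h₁ h₂ =>
    refine (add_nonneg h₁ h₂).trans_eq (CStarMatrix.ext fun j l => ?_)
    simp only [CStarMatrix.map_apply, CStarMatrix.add_apply, map_add]
  | mem M hM =>
    obtain ⟨N, rfl⟩ := hM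
    let W (i : ι) (r j : Fin k) : Matrix a b ℂ :=
      Matrix.of fun p q => ∑ p', N r j p p' * star (A i q p')
    -- Row `p` of the `a × b` matrix `W i r j` is parked in row `q₀` of block `(r, j)`, so that the
    -- square is taken over `b × b` blocks.
    let V (i : ι) (r : Fin k) (p : a) : CStarMatrix (Fin k) (Fin k) (Matrix b b ℂ) :=
      CStarMatrix.ofMatrix fun s j =>
        if s = r then Matrix.of fun q q' => if q = q₀ then W i r j p q' else 0 else 0
    have hV_apply (i : ι) (r : Fin k) (p : a) (s j : Fin k) : V i r p s j =
        if s = r then Matrix.of fun q q' => if q = q₀ then W i r j p q' else 0 else 0 := rfl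
    have hsum : ∑ i, ∑ r, ∑ p, star (V i r p) * V i r p = (star N * N).map (krausMap A) := by
      refine CStarMatrix.ext fun j l => ?_
      have hentry (i : ι) (r : Fin k) (p : a) : (star (V i r p) * V i r p) j l =
          Matrix.of fun q q' => star (W i r j p q) * W i r l p q' := by
        rw [CStarMatrix.mul_apply, Finset.sum_eq_single r]
        · ext q q'
          rw [CStarMatrix.star_apply]
          simp [hV_apply, Matrix.mul_apply, Matrix.star_apply]
        · intro s _ hs
          rw [hV_apply, if_neg hs, mul_zero]
        · simp
      have hW (i : ι) (r : Fin k) : ∑ p, Matrix.of (fun q q' => star (W i r j p q) * W i r l p q') =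
          A i * (star (N r j) * N r l) * (A i).conjTranspose := by
        have hWj (j : Fin k) : W i r j = N r j * (A i).conjTranspose := rfl
        have : A i * (star (N r j) * N r l) * (A i).conjTranspose =
            (W i r j).conjTranspose * W i r l := by
          rw [hWj, hWj, Matrix.conjTranspose_mul, Matrix.conjTranspose_conjTranspose,
            Matrix.star_eq_conjTranspose]
          simp only [Matrix.mul_assoc]
        rw [this]
        ext q q'
        simp [Matrix.mul_apply, Matrix.sum_apply]
      rw [CStarMatrix.map_apply, krausMap_apply, CStarMatrix.finsetSum_apply]
      refine Finset.sum_congr rfl fun i _ => ?_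
      rw [CStarMatrix.finsetSum_apply, CStarMatrix.mul_apply, Matrix.mul_sum, Matrix.sum_mul]
      refine Finset.sum_congr rfl fun r _ => ?_
      rw [CStarMatrix.finsetSum_apply, CStarMatrix.star_apply, ← hW]
      exact Finset.sum_congr rfl fun p _ => hentry i r p
    rw [← hsum]
    exact Finset.sum_nonneg fun i _ => Finset.sum_nonneg fun r _ => Finset.sum_nonneg fun p _ =>
      star_mul_self_nonneg _

/-- The channel with Kraus operators `A i`. -/
noncomputable def krausChannel {ι a b : Type*} [Fintype ι] [Fintype a] [DecidableEq a]
    [Fintype b] [DecidableEq b] [Nonempty b] (A : ι → Matrix b a ℂ)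
    (hA : ∑ i, (A i).conjTranspose * A i = 1) : QuantumChannel a b where
  toLinearMap := krausMap A
  map_cstarMatrix_nonneg' := krausMap_cstarMatrix_nonneg A
  trace_map := trace_krausMap hA

theorem tensorMap_krausMap {ι κ a b c d : Type*} [Fintype ι] [Fintype κ] [Fintype a]
    [DecidableEq a] [Fintype b] [DecidableEq b] [Fintype c] [DecidableEq c] [Fintype d]
    [DecidableEq d] (A : ι → Matrix b a ℂ) (B : κ → Matrix d c ℂ) :
    tensorMap (krausMap A) (krausMap B) = krausMap fun p : ι × κ => A p.1 ⊗ₖ B p.2 := by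
  ext1 X
  obtain ⟨t, rfl⟩ := (kroneckerLinearEquiv a a c c ℂ).surjective X
  induction t using TensorProduct.induction_on with
  | zero => simp
  | add x y hx hy => rw [map_add, map_add, map_add, hx, hy]
  | tmul x y =>
    simp [tensorMap, krausMap_apply, TensorProduct.sum_tmul, TensorProduct.tmul_sum,
      Fintype.sum_prod_type, Matrix.mul_kronecker_mul, Matrix.conjTranspose_kronecker, map_sum]
    rw [Finset.sum_comm]

/-! ### Product-free families and output rank -/

open Matrix in
/-- No product vector is orthogonal to all the matrices `K i`. -/
def IsProductFree {ι a b : Type*} [Fintype a] [Fintype b] (K : ι → Matrix b a ℂ) : Prop :=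
  ∀ (x : a → ℂ) (y : b → ℂ), (∀ i, y ⬝ᵥ K i *ᵥ x = 0) → x = 0 ∨ y = 0

open Matrix in
-- A common kernel vector `x` of the `K i` would make `x ⊗ y` orthogonal to the family for every
-- `y`.
theorem IsProductFree.posDef_sum {ι a b : Type*} [Fintype ι] [Fintype a] [Fintype b] [Nonempty b]
    {K : ι → Matrix b a ℂ} (hK : IsProductFree K) : (∑ i, (K i)ᴴ * K i).PosDef := by
  classical
  refine .of_dotProduct_mulVec_pos ?_ fun x hx => ?_
  · exact (posSemidef_sum _ fun i _ => posSemidef_conjTranspose_mul_self (K i)).isHermitian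
  · have h0 : ∀ i, 0 ≤ star x ⬝ᵥ ((K i)ᴴ * K i) *ᵥ x := fun i =>
      (posSemidef_conjTranspose_mul_self (K i)).dotProduct_mulVec_nonneg x
    rw [Matrix.sum_mulVec, dotProduct_sum]
    refine (Finset.sum_nonneg fun i _ => h0 i).lt_of_ne' fun h => ?_
    rw [Finset.sum_eq_zero_iff_of_nonneg fun i _ => h0 i] at h
    have hz : ∀ i, K i *ᵥ x = 0 := fun i => by
      have := h i (Finset.mem_univ _)
      rwa [← mulVec_mulVec, dotProduct_mulVec, vecMul_conjTranspose, star_star,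
        dotProduct_star_self_eq_zero] at this
    rcases hK x 1 fun i => by rw [hz]; simp with h | h
    · exact hx h
    · exact one_ne_zero h

open Matrix in
theorem IsProductFree.exists_normalization {ι a b : Type*} [Fintype ι] [Fintype a] [DecidableEq a]
    [Fintype b] [Nonempty b] {K : ι → Matrix b a ℂ} (hK : IsProductFree K) :
    ∃ C D : Matrix a a ℂ, C * D = 1 ∧ D * C = 1 ∧ ∑ i, (K i * D)ᴴ * (K i * D) = 1 := by
  obtain ⟨C, hC, h⟩ := CStarAlgebra.isStrictlyPositive_iff_eq_star_mul_self.mp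
    hK.posDef_sum.isStrictlyPositive
  obtain ⟨D, hCD, hDC⟩ := isUnit_iff_exists.mp hC
  refine ⟨C, D, hCD, hDC, ?_⟩
  calc ∑ i, (K i * D)ᴴ * (K i * D) = Dᴴ * (∑ i, (K i)ᴴ * K i) * D := by
        simp [Finset.sum_mul, Finset.mul_sum, Matrix.mul_assoc]
    _ = (C * D)ᴴ * (C * D) := by
        rw [h, conjTranspose_mul, star_eq_conjTranspose]; simp only [Matrix.mul_assoc]
    _ = 1 := by rw [hCD]; simp

open Matrix in
theorem IsProductFree.mul_right {ι a b : Type*} [Fintype a] [DecidableEq a]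
    [Fintype b] {K : ι → Matrix b a ℂ} (hK : IsProductFree K) {C D : Matrix a a ℂ}
    (h : C * D = 1) : IsProductFree fun i => K i * C := by
  have h' : D * C = 1 := mul_eq_one_comm.mp h
  intro x y hxy
  refine (hK (C *ᵥ x) y fun i => by simpa using hxy i).imp_left fun hx => ?_
  simpa [h'] using congrArg (D *ᵥ ·) hx

open Matrix in
-- If `y` is isotropic for the output, positivity forces `ρ (A i)ᴴ y = 0` for each `i`. Each
-- conjugated row of `ρ`, paired with `star y`, is then orthogonal to the family, so `ρ = 0`.
theorem IsProductFree.krausMap_posDef {ι a b : Type*} [Fintype ι] [Fintype a]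
    [Fintype b] {A : ι → Matrix b a ℂ} (hA : IsProductFree A)
    {ρ : Matrix a a ℂ} (hρ : ρ.PosSemidef) (hρ0 : ρ ≠ 0) : (krausMap A ρ).PosDef := by
  classical
  have hps : ∀ i, (A i * ρ * (A i)ᴴ).PosSemidef := fun i => hρ.mul_mul_conjTranspose_same (A i)
  refine .of_dotProduct_mulVec_pos (posSemidef_sum _ fun i _ => hps i).isHermitian fun y hy => ?_
  have h0 : ∀ i, 0 ≤ star y ⬝ᵥ (A i * ρ * (A i)ᴴ) *ᵥ y := fun i =>
    (hps i).dotProduct_mulVec_nonneg y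
  rw [krausMap_apply, Matrix.sum_mulVec, dotProduct_sum]
  refine (Finset.sum_nonneg fun i _ => h0 i).lt_of_ne' fun h => ?_
  rw [Finset.sum_eq_zero_iff_of_nonneg fun i _ => h0 i] at h
  have hz : ∀ i, ρ *ᵥ ((A i)ᴴ *ᵥ y) = 0 := fun i => by
    rw [← hρ.dotProduct_mulVec_zero_iff, ← h i (Finset.mem_univ _)]
    simp [← mulVec_mulVec, dotProduct_mulVec, star_mulVec]
  refine hρ0 (Matrix.ext fun r s => ?_)
  have hd (i : ι) : star y ⬝ᵥ A i *ᵥ (fun s => star (ρ r s)) = 0 := by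
    have e : star ((ρ *ᵥ ((A i)ᴴ *ᵥ y)) r) = star y ⬝ᵥ A i *ᵥ fun s => star (ρ r s) := by
      change star (ρ r ⬝ᵥ ((A i)ᴴ *ᵥ y)) = _
      rw [← star_dotProduct_star, star_mulVec, conjTranspose_conjTranspose, dotProduct_mulVec]
      rfl
    rw [← e, hz i]
    simp
  rcases hA _ _ hd with hx | hy'
  · simpa using congrFun hx s
  · exact absurd (star_eq_zero.mp hy') hy

theorem DensityMatrix.ne_zero {a : Type*} [Fintype a] (ρ : DensityMatrix a) : ρ.1 ≠ 0 := by
  intro h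
  have := ρ.2.2
  simp [h] at this

/-- The pure state with state vector proportional to `x`. -/
theorem exists_densityMatrix_smul_vecMulVec {a : Type*} [Fintype a] {x : a → ℂ} (hx : x ≠ 0) :
    ∃ (ρ : DensityMatrix a) (c : ℂ), ρ.1 = c • Matrix.vecMulVec x (star x) := by
  have hpos : 0 < x ⬝ᵥ star x :=
    (dotProduct_self_star_nonneg x).lt_of_ne' (by simpa using hx)
  refine ⟨⟨(x ⬝ᵥ star x)⁻¹ • Matrix.vecMulVec x (star x),
    (Matrix.posSemidef_vecMulVec_self_star x).smul (inv_nonneg.mpr hpos.le), ?_⟩, _, rfl⟩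
  rw [Matrix.trace_smul, Matrix.trace_vecMulVec, smul_eq_mul, inv_mul_cancel₀ hpos.ne']

theorem IsProductFree.minOutputEntropyZero_krausMap {ι a b : Type*} [Fintype ι] [Fintype a]
    [Nonempty a] [Fintype b] {A : ι → Matrix b a ℂ} (hA : IsProductFree A) :
    minOutputEntropyZero (krausMap A) = Real.log (Fintype.card b) := by
  classical
  obtain ⟨ρ₀, -⟩ := exists_densityMatrix_smul_vecMulVec (one_ne_zero (α := a → ℂ))
  have : Nonempty (DensityMatrix a) := ⟨ρ₀⟩
  have h : ∀ ρ : DensityMatrix a, renyiEntropyZero (krausMap A ρ.1) = Real.log (Fintype.card b) :=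
    fun ρ => by
      rw [renyiEntropyZero, Matrix.rank_of_isUnit _ (hA.krausMap_posDef ρ.2.1 ρ.ne_zero).isUnit]
  simp [minOutputEntropyZero, h]

theorem minOutputEntropyZero_le {a b : Type*} [Fintype a] [Fintype b]
    (N : Matrix a a ℂ →ₗ[ℂ] Matrix b b ℂ) (ρ : DensityMatrix a) :
    minOutputEntropyZero N ≤ renyiEntropyZero (N ρ.1) :=
  ciInf_le ⟨0, by rintro _ ⟨ρ, rfl⟩; exact Real.log_natCast_nonneg _⟩ ρ

theorem Matrix.rank_lt_card_of_vecMul_eq_zero {b : Type*} [Fintype b] {σ : Matrix b b ℂ}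
    {y : b → ℂ} (hy : y ≠ 0) (h : Matrix.vecMul y σ = 0) : σ.rank < Fintype.card b := by
  refine (Matrix.rank_le_card_width σ).lt_of_ne fun hr => hy ?_
  have htop : LinearMap.range σ.mulVecLin = ⊤ :=
    Submodule.eq_top_of_finrank_eq (by rw [Module.finrank_fintype_fun_eq_card]; exact hr)
  obtain ⟨v, hv⟩ := LinearMap.range_eq_top.mp htop (star y)
  rw [← dotProduct_self_star_eq_zero, ← hv, Matrix.mulVecLin_apply, Matrix.dotProduct_mulVec, h,
    zero_dotProduct]

open Matrix in
theorem minOutputEntropyZero_krausMap_le {ι a b : Type*} [Fintype ι] [Fintype a] [Fintype b]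
    (A : ι → Matrix b a ℂ) {x : a → ℂ} (hx : x ≠ 0) {y : b → ℂ} (hy : y ≠ 0)
    (h : ∀ i, y ⬝ᵥ A i *ᵥ x = 0) (hb : 1 < Fintype.card b) :
    minOutputEntropyZero (krausMap A) ≤ Real.log ((Fintype.card b : ℝ) - 1) := by
  obtain ⟨ρ, c, hρ⟩ := exists_densityMatrix_smul_vecMulVec hx
  refine (minOutputEntropyZero_le _ ρ).trans ?_
  have hz : Matrix.vecMul y (krausMap A ρ.1) = 0 := by
    rw [krausMap_apply, Matrix.vecMul_sum]
    refine Finset.sum_eq_zero fun i _ => ?_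
    rw [hρ, ← vecMul_vecMul, ← vecMul_vecMul, vecMul_smul, vecMul_vecMulVec, ← dotProduct_mulVec,
      h i]
    simp
  have hr : ((krausMap A ρ.1).rank : ℝ) ≤ (Fintype.card b : ℝ) - 1 := by
    rw [le_sub_iff_add_le]
    exact_mod_cast Matrix.rank_lt_card_of_vecMul_eq_zero hy hz
  rw [renyiEntropyZero]
  -- As `A` is arbitrary, the rank may vanish; then `Real.log 0 = 0` and `hb` is needed.
  rcases (Nat.zero_le (krausMap A ρ.1).rank).eq_or_lt with h0 | h0
  · rw [← h0]
    have : (2 : ℝ) ≤ Fintype.card b := by exact_mod_cast hb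
    simpa using Real.log_nonneg (by linarith)
  · exact Real.log_le_log (by exact_mod_cast h0) hr

/-! ### From orthogonal pairs to channels -/

/-- There are two families of `b × a` matrices, orthogonal to each other for the bilinear form
`(X, Y) ↦ tr (Xᵀ Y)`, neither of which is orthogonal to a product vector. -/
def HasOrthogonalProductFreePair (a b : Type*) [Fintype a] [Fintype b] : Prop :=
  ∃ (ι : Type) (_ : Fintype ι) (K L : ι → Matrix b a ℂ), IsProductFree K ∧ IsProductFree L ∧
    ∀ i j, ((K i).transpose * L j).trace = 0

open Matrix in
theorem IsProductFree.transpose {ι a b : Type*} [Fintype a] [Fintype b]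
    {K : ι → Matrix b a ℂ} (hK : IsProductFree K) : IsProductFree fun i => (K i)ᵀ := by
  intro x y h
  refine (hK y x fun i => ?_).symm
  rw [← h i, mulVec_transpose, dotProduct_mulVec, dotProduct_comm]

open Matrix in
theorem IsProductFree.submatrix {ι a a' b : Type*} [Fintype a] [Fintype a'] [Fintype b]
    {K : ι → Matrix b a ℂ} (hK : IsProductFree K) (e : a' ≃ a) :
    IsProductFree fun i => (K i).submatrix id e := by
  intro x y h
  refine (hK (x ∘ e.symm) y fun i => ?_).imp_left fun hx => ?_
  · rw [← h i, Matrix.submatrix_mulVec_equiv]; rfl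
  · ext j
    simpa using congrFun hx (e j)

open Matrix in
theorem HasOrthogonalProductFreePair.symm {a b : Type*} [Fintype a] [Fintype b]
    (h : HasOrthogonalProductFreePair a b) : HasOrthogonalProductFreePair b a := by
  obtain ⟨ι, _, K, L, hK, hL, hKL⟩ := h
  refine ⟨ι, inferInstance, _, _, hK.transpose, hL.transpose, fun i j => ?_⟩
  rw [transpose_transpose, trace_mul_comm, ← trace_transpose, transpose_mul, transpose_transpose,
    hKL]

open Matrix in
theorem HasOrthogonalProductFreePair.congr_left {a a' b : Type*} [Fintype a] [Fintype a']
    [Fintype b] (h : HasOrthogonalProductFreePair a b) (e : a' ≃ a) :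
    HasOrthogonalProductFreePair a' b := by
  obtain ⟨ι, _, K, L, hK, hL, hKL⟩ := h
  refine ⟨ι, inferInstance, _, _, hK.submatrix e, hL.submatrix e, fun i j => ?_⟩
  rw [← hKL i j, Matrix.trace, Matrix.trace, ← e.sum_comp]
  rfl

open Matrix in
theorem HasOrthogonalProductFreePair.exists_channels {a b : Type*} [Fintype a] [DecidableEq a]
    [Nonempty a] [Fintype b] [DecidableEq b] (hb : 1 < Fintype.card b)
    (h : HasOrthogonalProductFreePair a b) :
    ∃ N₁ N₂ : QuantumChannel a b,
      minOutputEntropyZero N₁.toLinearMap = Real.log (Fintype.card b) ∧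
      minOutputEntropyZero N₂.toLinearMap = Real.log (Fintype.card b) ∧
      minOutputEntropyZero (tensorMap N₁.toLinearMap N₂.toLinearMap) ≤
        Real.log ((Fintype.card b : ℝ) ^ 2 - 1) := by
  have : Nonempty b := Fintype.card_pos_iff.mp (by omega)
  obtain ⟨ι, _, K, L, hK, hL, hKL⟩ := h
  obtain ⟨C, D, hCD, hDC, hKD⟩ := hK.exists_normalization
  obtain ⟨E, F, hEF, hFE, hLF⟩ := hL.exists_normalization
  refine ⟨krausChannel _ hKD, krausChannel _ hLF,
    (hK.mul_right hDC).minOutputEntropyZero_krausMap,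
    (hL.mul_right hFE).minOutputEntropyZero_krausMap, ?_⟩
  change minOutputEntropyZero (tensorMap (krausMap _) (krausMap _)) ≤ _
  rw [tensorMap_krausMap]
  have hcard : ((Fintype.card (b × b) : ℕ) : ℝ) = (Fintype.card b : ℝ) ^ 2 := by
    rw [Fintype.card_prod, Nat.cast_mul, sq]
  rw [← hcard]
  -- The factors `E` and `Cᵀ` cancel the normalizations `F` and `D`, leaving `tr (Lⱼ Kᵢᵀ)`.
  refine minOutputEntropyZero_krausMap_le _ (x := vec (E * Cᵀ)) (y := vec 1) ?_ ?_ ?_ ?_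
  · rw [Ne, vec_eq_zero_iff]
    intro h0
    have h1 : F * (E * Cᵀ) * Dᵀ = 1 := by
      rw [← Matrix.mul_assoc, hFE, Matrix.one_mul, ← transpose_mul, hDC, transpose_one]
    rw [h0] at h1
    simp at h1
  · rw [Ne, vec_eq_zero_iff]
    exact one_ne_zero
  · rintro ⟨i, j⟩
    rw [kronecker_mulVec_vec, vec_dotProduct_vec, transpose_one, Matrix.one_mul]
    have : L j * F * (E * Cᵀ) * (K i * D)ᵀ = L j * (F * E) * (D * C)ᵀ * (K i)ᵀ := by
      simp only [transpose_mul, Matrix.mul_assoc]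
    rw [this, hFE, hDC, transpose_one, Matrix.mul_one, Matrix.mul_one, trace_mul_comm, hKL]
  · rw [Fintype.card_prod]
    nlinarith

/-! ### The coupling matrix -/

/-- The vectors `(i + 1, 1, …, 1)`. -/
def coeffVec {k n : ℕ} (i : Fin k) (l : Fin n) : ℂ := if (l : ℕ) = 0 then (i : ℂ) + 1 else 1

theorem coeffVec_ne_zero {k n : ℕ} (i : Fin k) (l : Fin n) : coeffVec i l ≠ 0 := by
  rw [coeffVec]
  split_ifs
  · exact Nat.cast_add_one_ne_zero _
  · exact one_ne_zero

/-- A symmetric matrix on `ℂ^k ⊗ ℂ^n` that maps no product vector `u ⊗ y ≠ 0` to `ℂ^k ⊗ y`, provided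
`2 ≤ k` and `3 ≤ n`. -/
noncomputable def couplingMatrix (k n : ℕ) : Matrix (Fin k × Fin n) (Fin k × Fin n) ℂ :=
  fun p q => (if p.1 = q.1 then coeffVec p.1 p.2 * coeffVec p.1 q.2 else 0) +
    if p.2 = q.2 then ((k - 1 : ℂ)⁻¹ - if p.1 = q.1 then 1 else 0) * (p.2 : ℕ) else 0

theorem couplingMatrix_comm {k n : ℕ} (p q : Fin k × Fin n) :
    couplingMatrix k n p q = couplingMatrix k n q p := by
  obtain ⟨i, l⟩ := p
  obtain ⟨j, r⟩ := q
  simp only [couplingMatrix]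
  by_cases h₁ : i = j <;> by_cases h₂ : l = r <;>
    simp [h₁, h₂, eq_comm (a := j), eq_comm (a := r), mul_comm]

theorem sum_couplingMatrix_mul {k n : ℕ} (u : Fin k → ℂ) (y : Fin n → ℂ) (i : Fin k) (l : Fin n) :
    ∑ j, ∑ r, couplingMatrix k n (i, l) (j, r) * (u j * y r) =
      u i * (∑ r, coeffVec i r * y r) * coeffVec i l +
        ((k - 1 : ℂ)⁻¹ * ∑ j, u j - u i) * (l : ℕ) * y l := by
  simp only [couplingMatrix, add_mul, ite_mul, zero_mul, Finset.sum_add_distrib, sub_mul, one_mul,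
    Finset.sum_sub_distrib, Finset.sum_ite_eq, Finset.sum_ite_irrel, Finset.sum_const_zero,
    Finset.mem_univ, if_true]
  congr 1
  · rw [Finset.mul_sum, Finset.sum_mul]
    exact Finset.sum_congr rfl fun r _ => by ring
  · simp only [Finset.mul_sum, Finset.sum_mul]
    congr 1
    · exact Finset.sum_congr rfl fun r _ => by ring
    · ring

/-- Put `gᵢ = uᵢ ⟨cᵢ, y⟩` and `wᵢ = s - uᵢ`, with `cᵢ` the coefficient vectors. The equations read
`gᵢ cᵢ(l) + wᵢ l y_l = vᵢ y_l`. If `g = 0`, the distinct weights `l` force `y` onto one coordinate,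
whence `u = 0`. Otherwise coordinates 0, 1, 2 determine `i + 1` from `y` whenever `gᵢ ≠ 0`, so `w`
lives at a single index `i₀`; but then `u i₀ = 0`, contradicting `g i₀ ≠ 0`. -/
theorem eq_zero_or_eq_zero_of_sum_couplingMatrix {k n : ℕ} (hk : 2 ≤ k) (hn : 3 ≤ n)
    (u v : Fin k → ℂ) (y : Fin n → ℂ)
    (h : ∀ i l, ∑ j, ∑ r, couplingMatrix k n (i, l) (j, r) * (u j * y r) = v i * y l) :
    u = 0 ∨ y = 0 := by
  simp only [sum_couplingMatrix_mul] at h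
  set s := (k - 1 : ℂ)⁻¹ * ∑ j, u j with hs
  have hk1 : (k - 1 : ℂ) ≠ 0 := by
    rw [sub_ne_zero]
    exact_mod_cast (by omega : k ≠ 1)
  -- The factor `(k - 1)⁻¹` is chosen for this identity: `w = 0` gives `u = 0`, and `w` supported at
  -- `i₀` gives `u i₀ = 0`.
  have hsum : ∑ i, (s - u i) = s := by
    have : ∑ j, u j = (k - 1 : ℂ) * s := by rw [hs, mul_inv_cancel_left₀ hk1]
    rw [Finset.sum_sub_distrib, this, Finset.sum_const, Finset.card_univ, Fintype.card_fin,
      nsmul_eq_mul]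
    ring
  by_contra! hne
  obtain ⟨hu, hy⟩ := hne
  obtain ⟨i₀, hi₀⟩ : ∃ i, s - u i ≠ 0 := by
    by_contra! hw
    refine hu (funext fun i => ?_)
    have hs0 : s = 0 := by rw [← hsum]; exact Finset.sum_eq_zero fun i _ => hw i
    simpa [hs0] using hw i
  by_cases hg : ∀ i, u i * (∑ r, coeffVec i r * y r) = 0
  · obtain ⟨l₀, hl₀⟩ := Function.ne_iff.mp hy
    have hsingle : ∀ l, l ≠ l₀ → y l = 0 := by
      intro l hl
      by_contra hyl
      have h₁ : (s - u i₀) * (l : ℕ) = v i₀ := mul_right_cancel₀ hyl (by simpa [hg] using h i₀ l)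
      have h₂ : (s - u i₀) * (l₀ : ℕ) = v i₀ := mul_right_cancel₀ hl₀ (by simpa [hg] using h i₀ l₀)
      have h₃ := mul_left_cancel₀ hi₀ (h₁.trans h₂.symm)
      exact hl (Fin.ext (by exact_mod_cast h₃))
    refine hu (funext fun i => ?_)
    have := hg i
    rw [Finset.sum_eq_single l₀ (fun l _ hl => by rw [hsingle l hl, mul_zero]) (by simp)] at this
    exact (mul_eq_zero.mp this).resolve_right (mul_ne_zero (coeffVec_ne_zero _ _) hl₀)
  · push Not at hg
    obtain ⟨i₁, hi₁⟩ := hg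
    have hy0 : ∀ l, y l ≠ 0 := fun l hl => by
      have := h i₁ l
      rw [hl, mul_zero, mul_zero, add_zero] at this
      exact mul_ne_zero hi₁ (coeffVec_ne_zero _ _) this
    have h0 (i) := h i ⟨0, by omega⟩
    have h1 (i) := h i ⟨1, by omega⟩
    have h2 (i) := h i ⟨2, by omega⟩
    have e0 := hy0 ⟨0, by omega⟩
    have e1 := hy0 ⟨1, by omega⟩
    have e2 := hy0 ⟨2, by omega⟩
    simp only [coeffVec, if_true, one_ne_zero, OfNat.ofNat_ne_zero, if_false, Nat.cast_zero,
      Nat.cast_one, Nat.cast_ofNat, mul_one, mul_zero, zero_mul, add_zero] at h0 h1 h2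
    generalize y ⟨0, _⟩ = y₀ at *
    generalize y ⟨1, _⟩ = y₁ at *
    generalize y ⟨2, _⟩ = y₂ at *
    set g : Fin k → ℂ := fun i => u i * ∑ r, coeffVec i r * y r with hgdef
    replace h0 (i) : g i * (i + 1) = v i * y₀ := h0 i
    replace h1 (i) : g i + (s - u i) * y₁ = v i * y₁ := h1 i
    replace h2 (i) : g i + (s - u i) * 2 * y₂ = v i * y₂ := h2 i
    have hw (i) : g i * (y₂ - y₁) = (s - u i) * (y₁ * y₂) := by
      linear_combination y₂ * h1 i - y₁ * h2 i
    have hgw (i) (hi : g i = 0) : s - u i = 0 := by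
      have := hw i
      rw [hi, zero_mul, eq_comm] at this
      exact (mul_eq_zero.mp this).resolve_right (mul_ne_zero e1 e2)
    have hv (i) (hi : g i ≠ 0) : (i + 1 : ℂ) * y₁ * y₂ = y₀ * y₂ + y₀ * (y₂ - y₁) := by
      apply mul_left_cancel₀ hi
      linear_combination y₁ * y₂ * h0 i - y₀ * y₂ * h1 i - y₀ * hw i
    have hg₀ : g i₀ ≠ 0 := fun h => hi₀ (hgw i₀ h)
    have hsupp (i) (hi : i ≠ i₀) : s - u i = 0 := by
      refine hgw i (by_contra fun hgi => hi ?_)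
      have := mul_right_cancel₀ e1 (mul_right_cancel₀ e2 ((hv i hgi).trans (hv i₀ hg₀).symm))
      exact Fin.ext (by exact_mod_cast add_right_cancel this)
    rw [Finset.sum_eq_single i₀ (fun i _ hi => hsupp i hi) (by simp)] at hsum
    have hu₀ : u i₀ = 0 := by linear_combination -hsum
    exact hg₀ (by rw [hgdef]; simp [hu₀])

theorem eq_zero_and_eq_zero_or_of_sum_couplingMatrix {k n : ℕ} (hk : 2 ≤ k) (hn : 3 ≤ n)
    (u v : Fin k → ℂ) (y : Fin n → ℂ)
    (h : ∀ i l, ∑ j, ∑ r, couplingMatrix k n (i, l) (j, r) * (u j * y r) = v i * y l) :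
    (u = 0 ∧ v = 0) ∨ y = 0 := by
  refine or_iff_not_imp_right.mpr fun hy => ?_
  have hu := (eq_zero_or_eq_zero_of_sum_couplingMatrix hk hn u v y h).resolve_right hy
  obtain ⟨l, hl⟩ := Function.ne_iff.mp hy
  refine ⟨hu, funext fun i => ?_⟩
  have := h i l
  simp only [hu, Pi.zero_apply, zero_mul, mul_zero, Finset.sum_const_zero] at this
  exact (mul_eq_zero.mp this.symm).resolve_right hl

/-! ### The orthogonal pair and the theorem -/

open Matrix in
theorem hasOrthogonalProductFreePair_sum {k n : ℕ} (hk : 2 ≤ k) (hn : 3 ≤ n) :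
    HasOrthogonalProductFreePair (Fin k ⊕ Fin k) (Fin n) := by
  let M := couplingMatrix k n
  have hδ (x : Fin k → ℂ) (y : Fin n → ℂ) (i l) :
      ∑ r, y r * ∑ j, (if (i, l) = (j, r) then 1 else 0) * x j = x i * y l := by
    simp [Prod.mk.injEq, ite_and, mul_comm]
  refine ⟨Fin k × Fin n, inferInstance,
    fun p => of fun r => Sum.elim (fun j => if p = (j, r) then 1 else 0) fun j => M p (j, r),
    fun p => of fun r => Sum.elim (fun j => -M p (j, r)) fun j => if p = (j, r) then 1 else 0,
    ?_, ?_, ?_⟩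
  · intro x y h
    -- Orthogonality to row `(i, l)` of `(1 | M)` is the `(i, l)` entry of `M (x_r ⊗ y) = -x_l ⊗ y`,
    -- for the two halves `x_l`, `x_r` of `x`.
    have hx (i l) : ∑ j, ∑ r, M (i, l) (j, r) * (x (.inr j) * y r) = -x (.inl i) * y l := by
      rw [neg_mul, ← add_eq_zero_iff_eq_neg, ← h (i, l), Finset.sum_comm]
      simp only [dotProduct, mulVec, of_apply, Fintype.sum_sum_type, Sum.elim_inl, Sum.elim_inr,
        mul_add, Finset.sum_add_distrib, hδ]
      simp only [Finset.mul_sum, mul_comm, mul_left_comm, add_comm]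
    refine (eq_zero_and_eq_zero_or_of_sum_couplingMatrix hk hn _ _ _ hx).imp_left fun ⟨hr, hl⟩ => ?_
    ext (j | j)
    · simpa using congrFun hl j
    · exact congrFun hr j
  · intro x y h
    have hx (i l) : ∑ j, ∑ r, M (i, l) (j, r) * (x (.inl j) * y r) = x (.inr i) * y l := by
      rw [← sub_eq_zero, ← neg_eq_zero, ← h (i, l), Finset.sum_comm]
      simp only [dotProduct, mulVec, of_apply, Fintype.sum_sum_type, Sum.elim_inl, Sum.elim_inr,
        mul_add, Finset.sum_add_distrib, hδ, neg_sub]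
      simp only [Finset.mul_sum, neg_mul, mul_neg, Finset.sum_neg_distrib, sub_eq_neg_add,
        mul_comm, mul_left_comm]
    refine (eq_zero_and_eq_zero_or_of_sum_couplingMatrix hk hn _ _ _ hx).imp_left fun ⟨hl, hr⟩ => ?_
    ext (j | j)
    · exact congrFun hl j
    · exact congrFun hr j
  · rintro p q
    simp only [Matrix.trace, Matrix.diag, Matrix.mul_apply, transpose_apply, of_apply,
      Fintype.sum_sum_type, Sum.elim_inl, Sum.elim_inr]
    rw [← Fintype.sum_prod_type', ← Fintype.sum_prod_type']
    simp [M, couplingMatrix_comm p q]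

theorem hasOrthogonalProductFreePair_fin {m n : ℕ} (hm : 2 < m) (hn : 2 < n) (hmn : Even (m * n)) :
    HasOrthogonalProductFreePair (Fin m) (Fin n) := by
  have key {m n : ℕ} (hm : 2 < m) (hn : 2 < n) (h : Even m) :
      HasOrthogonalProductFreePair (Fin m) (Fin n) := by
    obtain ⟨k, rfl⟩ := h
    exact (hasOrthogonalProductFreePair_sum (by omega) hn).congr_left finSumFinEquiv.symm
  exact (Nat.even_mul.mp hmn).elim (key hm hn) fun h => (key hn hm h).symm

theorem theorem1 (dA dB : ℕ) (hA : 2 < dA) (hB : 2 < dB) (hAB : Even (dA * dB)) :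
    ∃ N₁ N₂ : QuantumChannel (Fin dA) (Fin dB),
      minOutputEntropyZero N₁.toLinearMap = Real.log (dB : ℝ) ∧
      minOutputEntropyZero N₂.toLinearMap = Real.log (dB : ℝ) ∧
      minOutputEntropyZero (tensorMap N₁.toLinearMap N₂.toLinearMap) ≤
        Real.log ((dB : ℝ) ^ 2 - 1) ∧
      Real.log ((dB : ℝ) ^ 2 - 1) < 2 * Real.log (dB : ℝ) ∧
      minOutputEntropyZero (tensorMap N₁.toLinearMap N₂.toLinearMap) <
        minOutputEntropyZero N₁.toLinearMap + minOutputEntropyZero N₂.toLinearMap := by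
  have : Nonempty (Fin dA) := ⟨⟨0, by omega⟩⟩
  obtain ⟨N₁, N₂, h₁, h₂, h₁₂⟩ :=
    (hasOrthogonalProductFreePair_fin hA hB hAB).exists_channels (by simp; omega)
  rw [Fintype.card_fin] at h₁ h₂ h₁₂
  have hB' : (2 : ℝ) < dB := by exact_mod_cast hB
  have hlog : Real.log ((dB : ℝ) ^ 2 - 1) < 2 * Real.log (dB : ℝ) := by
    have h : 2 * Real.log (dB : ℝ) = Real.log ((dB : ℝ) ^ 2) := by rw [Real.log_pow]; norm_num
    rw [h]
    exact Real.log_lt_log (by nlinarith) (by linarith)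
  exact ⟨N₁, N₂, h₁, h₂, h₁₂, hlog, h₁₂.trans_lt (by rw [h₁, h₂]; linarith)⟩
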